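/- Let $d,m\ge 1$ be integers, let $\alpha_1,\dots,\alpha_m>0$, and let $\Omega=\mathbb{T}^d=\mathbb{R}^d/\mathbb{Z}^d$ be equipped with its normalized Lebesgue measure. For $T>0$ let $\mathcal{P}_T^{m,\infty}$ be the set of curves $p:[0,T]\to\Omega$ of class $W^{m,\infty}$ (i.e. $p$ is the projection of a continuous curve in $\mathbb{R}^d$ whose weak derivatives up to order $m$ are in $L^\infty([0,T])$) with $\|p^{(i)}\|_\infty\le\alpha_i$ for all $i\in\{1,\dots,m\}$, where $\|p^{(i)}\|_\infty$ is the essential supremum of the Euclidean norm of the $i$-th derivative. Let $\mathcal{M}(\mathcal{P}_T^{m,\infty})=\{p_*\gamma_T : p\in\mathcal{P}_T^{m,\infty}\}$, where $\gamma_T$ is the normalized Lebesgue measure on $[0,T]$. For $h:\Omega\to\mathbb{R}$ continuous and $\nu$ a finite signed measure on $\Omega$, let $(h\star\nu)(x)=\int_\Omega h(x-y)\,d\nu(y)$ and $\mathcal{N}_h(\nu)=\|h\star\nu\|_{L^2(\Omega)}$. Let $h:\Omega\to\mathbb{R}$ be a Lipschitz function, let $\pi$ be a Borel probability measure on $\Omega$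 and, for every $T>0$, let $\mu_T^*$ be any minimizer of $\mu\mapsto\mathcal{N}_h(\mu-\pi)$ over $\mathcal{M}(\mathcal{P}_T^{m,\infty})$. Then: (i) if all Fourier coefficients $\hat h(\xi)$, $\xi\in\mathbb{Z}^d$, are nonzero, then $\mu_T^*$ converges weakly to $\pi$ as $T\to\infty$, i.e. $\int_\Omega f\,d\mu_T^*\to\int_\Omega f\,d\pi$ for every continuous $f:\Omega\to\mathbb{R}$; (ii) $\mathcal{N}_h(\mu_T^*-\pi)=\mathcal{O}\left(T^{-\frac{m}{m(d+1)-1}}\right)$ as $T\to\infty$. -/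

import Mathlib

open MeasureTheory Filter Set
open scoped Topology ENNReal ContDiff Asymptotics

noncomputable section

namespace LineDrawing

/-- The normalized Lebesgue (Haar) measure `dx` on the torus `𝕋ᵈ = ℝᵈ / ℤᵈ`. -/
def torusVolume (d : ℕ) : Measure (UnitAddTorus (Fin d)) :=
  Measure.pi fun _ => AddCircle.haarAddCircle

/-- The quotient map `ℝᵈ → 𝕋ᵈ`. -/
def torusProj {d : ℕ} (x : EuclideanSpace ℝ (Fin d)) : UnitAddTorus (Fin d) :=
  fun i => (x i : UnitAddCircle)

/-- The convolution `(h ⋆ ν)(x) = ∫ h(x - y) dν(y)` of a function `h` on the torus with a finite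
signed measure `ν`. -/
def conv {d : ℕ} (h : UnitAddTorus (Fin d) → ℝ) (ν : SignedMeasure (UnitAddTorus (Fin d)))
    (x : UnitAddTorus (Fin d)) : ℝ :=
  ∫ᵛ y, h (x - y) ∂<•ν

/-- `𝒩_h(ν) = ‖h ⋆ ν‖₂`, the norm being that of `L²(𝕋ᵈ)`. -/
def kernelNorm {d : ℕ} (h : UnitAddTorus (Fin d) → ℝ)
    (ν : SignedMeasure (UnitAddTorus (Fin d))) : ℝ :=
  Real.sqrt (∫ x, (conv h ν x) ^ 2 ∂(torusVolume d))

/-- The signed measure `μ - π`. -/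
def diffMeasure {d : ℕ} (μ π : ProbabilityMeasure (UnitAddTorus (Fin d))) :
    SignedMeasure (UnitAddTorus (Fin d)) :=
  (μ : Measure (UnitAddTorus (Fin d))).toSignedMeasure -
    (π : Measure (UnitAddTorus (Fin d))).toSignedMeasure

/-- `g` is an `i`-th weak derivative of `q` on the interval `(0, T)`. -/
def IsWeakDeriv {d : ℕ} (T : ℝ) (i : ℕ) (q g : ℝ → EuclideanSpace ℝ (Fin d)) : Prop :=
  ∀ φ : ℝ → ℝ, ContDiff ℝ ∞ φ → HasCompactSupport φ → tsupport φ ⊆ Ioo 0 T →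
    ∫ t in Icc 0 T, iteratedDeriv i φ t • q t = (-1 : ℝ) ^ i • ∫ t in Icc 0 T, φ t • g t

/-- `q ∈ (W^{m,∞}([0, T]))ᵈ`: `q` has weak derivatives of all orders `0, …, m` in `L^∞([0, T])`.
Only the restriction of `q` to `[0, T]` matters. -/
def MemSobolevInfty {d : ℕ} (m : ℕ) (T : ℝ) (q : ℝ → EuclideanSpace ℝ (Fin d)) : Prop :=
  ∀ i ≤ m, ∃ g : ℝ → EuclideanSpace ℝ (Fin d),
    MemLp g ⊤ (volume.restrict (Icc 0 T)) ∧ IsWeakDeriv T i q g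

/-- The set `𝒫_T^{m,∞}` of admissible curves `p : [0, T] → 𝕋ᵈ` (as functions on `ℝ` whose values
outside `[0, T]` are irrelevant): `p` is given on `[0, T]` by a continuous curve `q` in `ℝᵈ`
of class `W^{m,∞}` whose weak derivatives satisfy `‖q⁽ⁱ⁾‖_∞ ≤ α i` for `1 ≤ i ≤ m`.
The lift `q` is determined by `p` up to a constant vector, so its derivatives are those of `p`. -/
def admissibleCurves (d m : ℕ) (α : ℕ → ℝ) (T : ℝ) : Set (ℝ → UnitAddTorus (Fin d)) :=
  {p | ∃ q : ℝ → EuclideanSpace ℝ (Fin d),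
    ContinuousOn q (Icc 0 T) ∧
    (∀ t ∈ Icc 0 T, p t = torusProj (q t)) ∧
    MemSobolevInfty m T q ∧
    ∀ i, 1 ≤ i → i ≤ m → ∃ g : ℝ → EuclideanSpace ℝ (Fin d),
      IsWeakDeriv T i q g ∧ AEStronglyMeasurable g (volume.restrict (Icc 0 T)) ∧
        eLpNorm g ⊤ (volume.restrict (Icc 0 T)) ≤ ENNReal.ofReal (α i)}

/-- The set `ℳ(𝒫_T^{m,∞})` of pushforwards `p_* γ_T` of the normalized Lebesgue measure `γ_T` on
`[0, T]` by admissible curves `p`. -/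
def curveMeasures (d m : ℕ) (α : ℕ → ℝ) (T : ℝ) :
    Set (ProbabilityMeasure (UnitAddTorus (Fin d))) :=
  {μ | ∃ p ∈ admissibleCurves d m α T,
    (μ : Measure (UnitAddTorus (Fin d))) =
      Measure.map p (ProbabilityTheory.cond volume (Icc 0 T))}

/-- `μ` is a projection of `π` on `ℳ(𝒫_T^{m,∞})`: a minimizer of `𝒩_h(ν - π)` over all `ν` in this
set. -/
def IsProjection {d : ℕ} (m : ℕ) (α : ℕ → ℝ) (h : UnitAddTorus (Fin d) → ℝ)
    (π : ProbabilityMeasure (UnitAddTorus (Fin d))) (T : ℝ)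
    (μ : ProbabilityMeasure (UnitAddTorus (Fin d))) : Prop :=
  μ ∈ curveMeasures d m α T ∧
    ∀ ν ∈ curveMeasures d m α T,
      kernelNorm h (diffMeasure μ π) ≤ kernelNorm h (diffMeasure ν π)

end LineDrawing

end

noncomputable section

namespace LineDrawing

/-! ### Smooth curves are admissible -/

/-! The rate comes from one explicit competitor. On the line through 0 with direction `(1/n, 1/n²,
…, 1/n^d)`, the points with integer parameter `k < n^d` are `1/n`-dense in the torus. Assign each
point of the torus to such a point, and let a smooth curve visit them in order, resting at each for
a time proportional to the `π`-mass of its cell and spending time `τ` on each move. Against a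
`K`-Lipschitz function bounded by `M`, the resulting measure differs from `π` by at most `K/n`
(discretisation) plus `2M` times the fraction `n^d τ / T` of time spent moving
(`exists_curveMeasure_close`).

A move has length of order `1/n`, so its `i`-th derivative has order `τ⁻ⁱ/n`; all orders `i ≤ m` are
admissible for `τ = c n^(-1/m)`. Moving then takes time `c n^(d-1/m)`, a fraction at most `c/n` once
`T ≥ n^(d+1-1/m)`. Taking `n` of order `T^(m/(m(d+1)-1))` gives (ii), by minimality of `μ T`.

For (i), each Fourier coefficient of `h ⋆ (μ - π)` is a product bounded by the kernel norm
(`norm_mFourierCoeff_mul_le_kernelNorm`). When no coefficient of `h` vanishes, those of `μ T`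
converge to those of `π`, and density of trigonometric polynomials gives weak convergence. -/

theorem integral_Icc_deriv_smul_of_tsupport_subset {E : Type*} [NormedAddCommGroup E]
    [NormedSpace ℝ E] [CompleteSpace E] {T : ℝ} (hT : 0 ≤ T) {φ : ℝ → ℝ} {g : ℝ → E}
    (hφ : ContDiff ℝ ∞ φ) (hsupp : tsupport φ ⊆ Ioo 0 T) (hg : ContDiff ℝ ∞ g) :
    ∫ t in Icc 0 T, deriv φ t • g t = -∫ t in Icc 0 T, φ t • deriv g t := by
  have hφ0 : φ 0 = 0 := image_eq_zero_of_notMem_tsupport fun h => lt_irrefl _ (hsupp h).1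
  have hφT : φ T = 0 := image_eq_zero_of_notMem_tsupport fun h => lt_irrefl _ (hsupp h).2
  have hdφ : Continuous (deriv φ) := hφ.continuous_deriv (by simp)
  have hdg : Continuous (deriv g) := hg.continuous_deriv (by simp)
  have key := intervalIntegral.integral_smul_deriv_eq_deriv_smul (a := 0) (b := T)
    (u := φ) (v := g) (u' := deriv φ) (v' := deriv g)
    (fun x _ => (hφ.differentiable (by simp) x).hasDerivAt)
    (fun x _ => (hg.differentiable (by simp) x).hasDerivAt)
    (hdφ.intervalIntegrable _ _) (hdg.intervalIntegrable _ _)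
  rw [intervalIntegral.integral_of_le hT, intervalIntegral.integral_of_le hT, hφ0, hφT] at key
  rw [integral_Icc_eq_integral_Ioc, integral_Icc_eq_integral_Ioc, key]
  simp

theorem isWeakDeriv_iteratedDeriv {d : ℕ} {T : ℝ} (hT : 0 ≤ T)
    {q : ℝ → EuclideanSpace ℝ (Fin d)} (hq : ContDiff ℝ ∞ q) (i : ℕ) :
    IsWeakDeriv T i q (iteratedDeriv i q) := by
  induction i with
  | zero => intro φ _ _ _; simp
  | succ i ih =>
    intro φ hφ hcpt hsupp
    have hdφ : ContDiff ℝ ∞ (deriv φ) := hφ.iterate_deriv 1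
    have hiq : ContDiff ℝ ∞ (iteratedDeriv i q) := by
      rw [iteratedDeriv_eq_iterate]; exact hq.iterate_deriv i
    rw [iteratedDeriv_succ', iteratedDeriv_succ,
      ih (deriv φ) hdφ hcpt.deriv (tsupport_deriv_subset.trans hsupp),
      integral_Icc_deriv_smul_of_tsupport_subset hT hφ hsupp hiq, pow_succ]
    simp

theorem continuous_torusProj {d : ℕ} : Continuous (torusProj (d := d)) := by
  unfold torusProj
  refine continuous_pi fun i => ?_
  exact (AddCircle.continuous_mk' (1 : ℝ)).comp (by fun_prop)

theorem torusProj_comp_mem_admissibleCurves {d m : ℕ} {α : ℕ → ℝ} {T : ℝ} (hT : 0 ≤ T)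
    {q : ℝ → EuclideanSpace ℝ (Fin d)} (hq : ContDiff ℝ ∞ q)
    (hα : ∀ i, 1 ≤ i → i ≤ m → ∀ t, ‖iteratedDeriv i q t‖ ≤ α i) :
    torusProj ∘ q ∈ admissibleCurves d m α T := by
  have hcont (i : ℕ) : Continuous (iteratedDeriv i q) :=
    hq.continuous_iteratedDeriv i (by exact_mod_cast le_top)
  refine ⟨q, hq.continuous.continuousOn, fun t _ => rfl, fun i _ => ⟨iteratedDeriv i q, ?_,
    isWeakDeriv_iteratedDeriv hT hq i⟩, fun i h1 hi => ⟨iteratedDeriv i q,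
    isWeakDeriv_iteratedDeriv hT hq i, (hcont i).aestronglyMeasurable, ?_⟩⟩
  · obtain ⟨C, hC⟩ := (isCompact_Icc (a := (0 : ℝ)) (b := T)).exists_bound_of_continuousOn
      (hcont i).continuousOn
    exact memLp_top_of_bound (hcont i).aestronglyMeasurable C
      ((ae_restrict_iff' measurableSet_Icc).2 (Eventually.of_forall hC))
  · refine eLpNorm_le_of_ae_bound (Eventually.of_forall (hα i h1 hi)) |>.trans ?_
    simp

/-! ### A smooth staircase -/

theorem iteratedDeriv_smoothTransition_of_nonpos (i : ℕ) {x : ℝ} (hx : x ≤ 0) :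
    iteratedDeriv i Real.smoothTransition x = 0 := by
  have hcont : Continuous (iteratedDeriv i Real.smoothTransition) :=
    (Real.smoothTransition.contDiff (n := ⊤)).continuous_iteratedDeriv i (by exact_mod_cast le_top)
  have hsub : Iio (0 : ℝ) ⊆ {x | iteratedDeriv i Real.smoothTransition x = 0} := by
    have : EqOn Real.smoothTransition (fun _ => (0 : ℝ)) (Iio 0) := fun y hy =>
      Real.smoothTransition.zero_of_nonpos (le_of_lt hy)
    intro y hy
    have h2 := this.iteratedDeriv_of_isOpen isOpen_Iio i hy
    simpa [iteratedDeriv_const] using h2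
  -- Continuity of the derivative extends the vanishing to the endpoint.
  have := closure_minimal hsub (isClosed_eq hcont continuous_const)
  rw [closure_Iio] at this
  exact this hx

theorem iteratedDeriv_smoothTransition_of_one_le {i : ℕ} (hi : 1 ≤ i) {x : ℝ} (hx : 1 ≤ x) :
    iteratedDeriv i Real.smoothTransition x = 0 := by
  have hcont : Continuous (iteratedDeriv i Real.smoothTransition) :=
    (Real.smoothTransition.contDiff (n := ⊤)).continuous_iteratedDeriv i (by exact_mod_cast le_top)
  have hsub : Ioi (1 : ℝ) ⊆ {x | iteratedDeriv i Real.smoothTransition x = 0} := by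
    have : EqOn Real.smoothTransition (fun _ => (1 : ℝ)) (Ioi 1) := fun y hy =>
      Real.smoothTransition.one_of_one_le (le_of_lt hy)
    intro y hy
    have h2 := this.iteratedDeriv_of_isOpen isOpen_Ioi i hy
    simpa [iteratedDeriv_const, show i ≠ 0 by omega] using h2
  have := closure_minimal hsub (isClosed_eq hcont continuous_const)
  rw [closure_Ioi] at this
  exact this hx

theorem exists_bound_iteratedDeriv_smoothTransition {i : ℕ} (hi : 1 ≤ i) :
    ∃ C : ℝ, 0 ≤ C ∧ ∀ x, |iteratedDeriv i Real.smoothTransition x| ≤ C := by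
  have hcont : Continuous (iteratedDeriv i Real.smoothTransition) :=
    (Real.smoothTransition.contDiff (n := ⊤)).continuous_iteratedDeriv i (by exact_mod_cast le_top)
  obtain ⟨C, hC⟩ := (isCompact_Icc (a := (0 : ℝ)) (b := 1)).exists_bound_of_continuousOn
    hcont.continuousOn
  have hC0 : 0 ≤ C := (norm_nonneg _).trans (hC 0 (by simp))
  refine ⟨C, hC0, fun x => ?_⟩
  rcases le_total x 0 with h0 | h0
  · simpa [iteratedDeriv_smoothTransition_of_nonpos i h0] using hC0
  rcases le_total 1 x with h1 | h1
  · simpa [iteratedDeriv_smoothTransition_of_one_le hi h1] using hC0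
  exact hC x ⟨h0, h1⟩

/-- The time at which stage `k` starts, when stage `j` consists of a rest of length `w j` followed
by a move of length `τ`. -/
def stageStart (w : ℕ → ℝ) (τ : ℝ) (k : ℕ) : ℝ :=
  ∑ j ∈ Finset.range k, (w j + τ)

/-- A smooth function climbing from `0` to `N`, which rests at `k` during a time `w k` and then
moves from `k` to `k + 1` in time `τ`. -/
def staircase (N : ℕ) (w : ℕ → ℝ) (τ : ℝ) (t : ℝ) : ℝ :=
  ∑ k ∈ Finset.range N, Real.smoothTransition (τ⁻¹ * (t - (stageStart w τ k + w k)))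

theorem stageStart_succ (w : ℕ → ℝ) (τ : ℝ) (k : ℕ) :
    stageStart w τ (k + 1) = stageStart w τ k + w k + τ := by
  rw [stageStart, Finset.sum_range_succ, ← stageStart]; ring

section Staircase

variable {w : ℕ → ℝ} {τ : ℝ}

theorem stageStart_mono (hw : ∀ k, 0 ≤ w k) (hτ : 0 < τ) : Monotone (stageStart w τ) :=
  monotone_nat_of_le_succ fun k => by rw [stageStart_succ]; linarith [hw k]

theorem contDiff_staircase (N : ℕ) (w : ℕ → ℝ) (τ : ℝ) : ContDiff ℝ ∞ (staircase N w τ) := by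
  unfold staircase
  refine ContDiff.sum fun k _ => ?_
  exact (Real.smoothTransition.contDiff (n := ⊤)).comp (by fun_prop)

theorem smoothTransition_stage_of_lt (hw : ∀ k, 0 ≤ w k) (hτ : 0 < τ) {j k : ℕ} (hjk : j < k)
    {t : ℝ} (ht : stageStart w τ k ≤ t) : 1 ≤ τ⁻¹ * (t - (stageStart w τ j + w j)) := by
  have h1 := stageStart_mono hw hτ (Nat.succ_le_of_lt hjk)
  rw [Nat.succ_eq_add_one, stageStart_succ] at h1
  rw [le_inv_mul_iff₀ hτ]
  linarith

theorem smoothTransition_stage_of_le (hw : ∀ k, 0 ≤ w k) (hτ : 0 < τ) {j k : ℕ} (hjk : k ≤ j)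
    {t : ℝ} (ht : t ≤ stageStart w τ k + w k) : τ⁻¹ * (t - (stageStart w τ j + w j)) ≤ 0 := by
  refine mul_nonpos_of_nonneg_of_nonpos (inv_nonneg.2 hτ.le) ?_
  rcases hjk.eq_or_lt with rfl | hlt
  · linarith
  have h1 := stageStart_mono hw hτ (Nat.succ_le_of_lt hlt)
  rw [Nat.succ_eq_add_one, stageStart_succ] at h1
  linarith [hw j]

theorem staircase_eq_of_mem_rest (hw : ∀ k, 0 ≤ w k) (hτ : 0 < τ) {N k : ℕ} (hk : k < N) {t : ℝ}
    (ht : t ∈ Icc (stageStart w τ k) (stageStart w τ k + w k)) : staircase N w τ t = k := by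
  have hterm : ∀ j ∈ Finset.range N,
      Real.smoothTransition (τ⁻¹ * (t - (stageStart w τ j + w j))) =
        if j ∈ Finset.range k then 1 else 0 := by
    intro j _
    split_ifs with hj
    · exact Real.smoothTransition.one_of_one_le
        (smoothTransition_stage_of_lt hw hτ (Finset.mem_range.1 hj) ht.1)
    · exact Real.smoothTransition.zero_of_nonpos
        (smoothTransition_stage_of_le hw hτ (by simpa using hj) ht.2)
  rw [staircase, Finset.sum_congr rfl hterm, Finset.sum_ite_mem,
    Finset.inter_eq_right.2 (Finset.range_subset_range.2 hk.le)]
  simp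

theorem iteratedDeriv_staircase (N : ℕ) (w : ℕ → ℝ) (τ : ℝ) (i : ℕ) (t : ℝ) :
    iteratedDeriv i (staircase N w τ) t = ∑ k ∈ Finset.range N,
      τ⁻¹ ^ i * iteratedDeriv i Real.smoothTransition (τ⁻¹ * (t - (stageStart w τ k + w k))) := by
  have hσ : ContDiff ℝ i Real.smoothTransition := Real.smoothTransition.contDiff (n := i)
  unfold staircase
  have hterm (k : ℕ) : ContDiff ℝ i fun t : ℝ =>
      Real.smoothTransition (τ⁻¹ * (t - (stageStart w τ k + w k))) := hσ.comp (by fun_prop)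
  rw [iteratedDeriv_fun_sum fun k _ => (hterm k).contDiffAt]
  refine Finset.sum_congr rfl fun k _ => ?_
  have h1 := congrFun (iteratedDeriv_comp_sub_const i
    (fun z => Real.smoothTransition (τ⁻¹ * z)) (stageStart w τ k + w k)) t
  rw [h1, iteratedDeriv_comp_const_mul hσ]

/-- The moves occupy disjoint time intervals, so at most one summand is nonzero at any time. Hence
the bound does not grow with `N`. -/
theorem abs_iteratedDeriv_staircase_le (hw : ∀ k, 0 ≤ w k) (hτ : 0 < τ) {i : ℕ} (hi : 1 ≤ i)
    {C : ℝ} (hC0 : 0 ≤ C) (hC : ∀ x, |iteratedDeriv i Real.smoothTransition x| ≤ C) (N : ℕ)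
    (t : ℝ) : |iteratedDeriv i (staircase N w τ) t| ≤ τ⁻¹ ^ i * C := by
  rw [iteratedDeriv_staircase, ← Finset.mul_sum, abs_mul, abs_of_nonneg (by positivity)]
  refine mul_le_mul_of_nonneg_left ?_ (by positivity)
  by_cases hex : ∃ k ∈ Finset.range N,
      iteratedDeriv i Real.smoothTransition (τ⁻¹ * (t - (stageStart w τ k + w k))) ≠ 0
  · obtain ⟨k, hk, hne⟩ := hex
    have h0 : 0 < τ⁻¹ * (t - (stageStart w τ k + w k)) := by
      by_contra! h
      exact hne (iteratedDeriv_smoothTransition_of_nonpos i h)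
    have h1 : τ⁻¹ * (t - (stageStart w τ k + w k)) < 1 := by
      by_contra! h
      exact hne (iteratedDeriv_smoothTransition_of_one_le hi h)
    have h0' : stageStart w τ k + w k < t := by
      have := pos_of_mul_pos_right h0 (inv_nonneg.2 hτ.le)
      linarith
    have h1' : t < stageStart w τ (k + 1) := by
      rw [inv_mul_lt_iff₀ hτ] at h1
      rw [stageStart_succ]; linarith
    rw [Finset.sum_eq_single_of_mem k hk]
    · exact hC _
    intro j _ hjk
    rcases lt_or_gt_of_ne hjk with hlt | hgt
    · exact iteratedDeriv_smoothTransition_of_one_le hi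
        (smoothTransition_stage_of_lt hw hτ hlt (by linarith [hw k]))
    · exact iteratedDeriv_smoothTransition_of_nonpos i
        (smoothTransition_stage_of_le hw hτ (Nat.succ_le_of_lt hgt) (by
          rw [Nat.succ_eq_add_one]; linarith [hw (k + 1)]))
  · push Not at hex
    rw [Finset.sum_eq_zero hex]
    simpa using hC0

/-- The integral of a function which takes the value `c k` during the rest of stage `k`. -/
theorem abs_integral_stages_sub_le (hw : ∀ k, 0 ≤ w k) (hτ : 0 < τ) {g : ℝ → ℝ}
    (hg : Continuous g) {M : ℝ} (hM : ∀ t, |g t| ≤ M) {c : ℕ → ℝ} (N : ℕ)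
    (hc : ∀ k < N, ∀ t ∈ Icc (stageStart w τ k) (stageStart w τ k + w k), g t = c k) :
    |(∫ t in (0 : ℝ)..stageStart w τ N, g t) - ∑ k ∈ Finset.range N, w k * c k| ≤ N * τ * M := by
  induction N with
  | zero => simp [stageStart]
  | succ N ih =>
    have hi (a b : ℝ) : IntervalIntegrable g volume a b := hg.intervalIntegrable a b
    have hrest : ∫ t in stageStart w τ N..(stageStart w τ N + w N), g t = w N * c N := by
      rw [intervalIntegral.integral_congr (g := fun _ => c N)]
      · simp
      · intro t ht
        rw [uIcc_of_le (by linarith [hw N])] at ht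
        exact hc N (Nat.lt_succ_self N) t ht
    have hmove : |∫ t in (stageStart w τ N + w N)..stageStart w τ (N + 1), g t| ≤ τ * M := by
      have := intervalIntegral.norm_integral_le_of_norm_le_const
        (a := stageStart w τ N + w N) (b := stageStart w τ (N + 1)) (f := g) (C := M)
        fun t _ => hM t
      rw [stageStart_succ, add_sub_cancel_left, abs_of_pos hτ, Real.norm_eq_abs] at this
      rw [stageStart_succ]; linarith
    have ih' := ih fun k hk => hc k (by omega)
    rw [← intervalIntegral.integral_add_adjacent_intervals (hi 0 (stageStart w τ N)) (hi _ _),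
      ← intervalIntegral.integral_add_adjacent_intervals
        (hi (stageStart w τ N) (stageStart w τ N + w N)) (hi _ _), hrest, Finset.sum_range_succ]
    rw [abs_le] at ih' hmove ⊢
    push_cast
    constructor <;> linarith [ih'.1, ih'.2, hmove.1, hmove.2]

end Staircase

/-! ### Points of a line which are evenly spread on the torus -/

/-- The integer multiples `k / n ^ (i + 1)`, `k < n ^ d`, are `1 / n`-dense modulo `1`. -/
theorem exists_nat_forall_abs_sub_le {n : ℕ} (hn : 1 ≤ n) (y : ℕ → ℝ) (d : ℕ) :
    ∃ k < n ^ d, ∀ i < d, ∃ z : ℤ, |(k : ℝ) * ((n : ℝ)⁻¹) ^ (i + 1) - y i - z| ≤ (n : ℝ)⁻¹ := by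
  have hn0 : (0 : ℝ) < n := by exact_mod_cast hn
  induction d with
  | zero => exact ⟨0, by simp, by simp⟩
  | succ d ih =>
    obtain ⟨k, hk, hkd⟩ := ih
    set u := Int.fract (y d)
    have hu0 : 0 ≤ u := Int.fract_nonneg _
    have hu1 : u < 1 := Int.fract_lt_one _
    set a := ⌊n * u⌋₊
    have ha : (a : ℝ) ≤ n * u := Nat.floor_le (by positivity)
    have ha' : n * u < a + 1 := Nat.lt_floor_add_one _
    have han : a < n := by
      have : (a : ℝ) < n := ha.trans_lt (by nlinarith)
      exact_mod_cast this
    -- `a` becomes the leading base-`n` digit. It shifts the earlier coordinates by integers and the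
    -- new one by `a / n`, which lies within `1/n` below `u`; the old `k < n ^ d` adds between `0`
    -- and `1/n`, so the two errors have opposite signs.
    refine ⟨k + a * n ^ d, ?_, fun i hi => ?_⟩
    · calc k + a * n ^ d < n ^ d + a * n ^ d := by omega
        _ = (a + 1) * n ^ d := by ring
        _ ≤ n * n ^ d := Nat.mul_le_mul_right _ han
        _ = n ^ (d + 1) := by ring
    rcases Nat.lt_succ_iff_lt_or_eq.1 hi with hlt | rfl
    · obtain ⟨z, hz⟩ := hkd i hlt
      refine ⟨z + a * n ^ (d - (i + 1)), ?_⟩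
      have hpow : (n : ℝ) ^ d * (n : ℝ)⁻¹ ^ (i + 1) = (n : ℝ) ^ (d - (i + 1)) := by
        rw [inv_pow, ← div_eq_mul_inv, pow_sub₀ _ hn0.ne' (by omega), div_eq_mul_inv]
      convert hz using 2
      push_cast
      rw [← hpow]; ring
    · refine ⟨-⌊y i⌋, ?_⟩
      have hy : y i = ⌊y i⌋ + u := (Int.floor_add_fract _).symm
      have hkk : (k : ℝ) < (n : ℝ) ^ i := by exact_mod_cast hk
      have hinv : (n : ℝ) ^ i * (n : ℝ)⁻¹ ^ (i + 1) = (n : ℝ)⁻¹ := by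
        rw [pow_succ, ← mul_assoc, ← mul_pow, mul_inv_cancel₀ hn0.ne', one_pow, one_mul]
      have h1 : (k : ℝ) * (n : ℝ)⁻¹ ^ (i + 1) ≤ (n : ℝ)⁻¹ := by
        exact (mul_le_mul_of_nonneg_right hkk.le (by positivity)).trans_eq hinv
      have h2 : 0 ≤ (k : ℝ) * (n : ℝ)⁻¹ ^ (i + 1) := by positivity
      have h3 : (a : ℝ) * (n : ℝ)⁻¹ ≤ u := by
        rw [← div_eq_mul_inv, div_le_iff₀ hn0]; linarith
      have h4 : u ≤ a * (n : ℝ)⁻¹ + (n : ℝ)⁻¹ := by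
        rw [← add_one_mul, ← div_eq_mul_inv, le_div_iff₀ hn0]; linarith
      have h5 : ((k + a * n ^ i : ℕ) : ℝ) * (n : ℝ)⁻¹ ^ (i + 1) - y i - ((-⌊y i⌋ : ℤ) : ℝ) =
          k * (n : ℝ)⁻¹ ^ (i + 1) + a * (n : ℝ)⁻¹ - u := by
        push_cast
        linear_combination (a : ℝ) * hinv - hy
      rw [h5, abs_le]
      constructor <;> linarith

/-- The direction of a line whose points with integer parameter are evenly spread on the torus. -/
def lineDirection (d n : ℕ) : EuclideanSpace ℝ (Fin d) :=
  WithLp.toLp 2 fun i => ((n : ℝ)⁻¹) ^ (i.val + 1)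

theorem norm_lineDirection_le (d : ℕ) {n : ℕ} (hn : 1 ≤ n) :
    ‖lineDirection d n‖ ≤ d * (n : ℝ)⁻¹ := by
  have hn0 : (1 : ℝ) ≤ n := by exact_mod_cast hn
  have h1 : ∀ i : Fin d, ‖lineDirection d n i‖ ≤ (n : ℝ)⁻¹ := by
    intro i
    have : lineDirection d n i = ((n : ℝ)⁻¹) ^ (i.val + 1) := rfl
    rw [this, Real.norm_of_nonneg (by positivity)]
    exact pow_le_of_le_one (by positivity) (inv_le_one_of_one_le₀ hn0) (by omega)
  rw [EuclideanSpace.norm_eq]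
  refine Real.sqrt_le_iff.2 ⟨by positivity, ?_⟩
  calc ∑ i, ‖lineDirection d n i‖ ^ 2 ≤ ∑ _i : Fin d, (n : ℝ)⁻¹ ^ 2 :=
        Finset.sum_le_sum fun i _ => pow_le_pow_left₀ (norm_nonneg _) (h1 i) 2
    _ = d * (n : ℝ)⁻¹ ^ 2 := by simp
    _ ≤ (d * (n : ℝ)⁻¹) ^ 2 := by
        rw [mul_pow]
        refine mul_le_mul_of_nonneg_right ?_ (by positivity)
        exact_mod_cast Nat.le_self_pow two_ne_zero d

theorem exists_dist_torusProj_lineDirection_le {d n : ℕ} (hn : 1 ≤ n)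
    (y : UnitAddTorus (Fin d)) :
    ∃ k < n ^ d, dist (torusProj ((k : ℝ) • lineDirection d n)) y ≤ (n : ℝ)⁻¹ := by
  choose r hr using fun i => QuotientAddGroup.mk_surjective (y i)
  -- The value `0` beyond `d` only makes the target a sequence on `ℕ`; those entries play no role.
  obtain ⟨k, hk, hkd⟩ := exists_nat_forall_abs_sub_le hn
    (fun i => if h : i < d then r ⟨i, h⟩ else 0) d
  refine ⟨k, hk, (dist_pi_le_iff (by positivity)).2 fun i => ?_⟩
  obtain ⟨z, hz⟩ := hkd i i.2
  have hcoe : torusProj ((k : ℝ) • lineDirection d n) i - y i =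
      (((k : ℝ) * (n : ℝ)⁻¹ ^ (i.val + 1) - r i - z : ℝ) : UnitAddCircle) := by
    rw [← hr i]
    have hz0 : ((z : ℝ) : UnitAddCircle) = 0 := by
      rw [AddCircle.coe_eq_zero_iff]; exact ⟨z, by simp⟩
    rw [AddCircle.coe_sub, hz0, sub_zero, AddCircle.coe_sub]
    rfl
  rw [dist_eq_norm, hcoe]
  refine (QuotientAddGroup.norm_mk_le_norm).trans ?_
  simpa [i.2] using hz

/-! ### Curve measures close to a given probability measure -/

/-- An index `k` such that the point of parameter `k` on the line of direction `lineDirection d n`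
is close to `y`. -/
def nearestIndex {d n : ℕ} (hn : 1 ≤ n) (y : UnitAddTorus (Fin d)) : ℕ :=
  Nat.find (exists_dist_torusProj_lineDirection_le hn y)

theorem nearestIndex_lt {d n : ℕ} (hn : 1 ≤ n) (y : UnitAddTorus (Fin d)) :
    nearestIndex hn y < n ^ d :=
  (Nat.find_spec (exists_dist_torusProj_lineDirection_le hn y)).1

theorem dist_nearestIndex_le {d n : ℕ} (hn : 1 ≤ n) (y : UnitAddTorus (Fin d)) :
    dist (torusProj ((nearestIndex hn y : ℝ) • lineDirection d n)) y ≤ (n : ℝ)⁻¹ :=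
  (Nat.find_spec (exists_dist_torusProj_lineDirection_le hn y)).2

/-- Taking the least valid index makes the selection measurable, since being within `1/n` of a fixed
point is a closed condition. -/
theorem measurable_nearestIndex {d n : ℕ} (hn : 1 ≤ n) :
    Measurable (nearestIndex (d := d) hn) := by
  refine measurable_find _ fun k => ?_
  have hclosed : IsClosed {y : UnitAddTorus (Fin d) |
      dist (torusProj ((k : ℝ) • lineDirection d n)) y ≤ (n : ℝ)⁻¹} :=
    isClosed_le (by fun_prop) continuous_const
  exact (MeasurableSet.const _).inter hclosed.measurableSet

theorem sum_measureReal_nearestIndex {d n : ℕ} (hn : 1 ≤ n)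
    (π : ProbabilityMeasure (UnitAddTorus (Fin d))) (c : ℕ → ℝ) :
    ∫ y, c (nearestIndex hn y) ∂(π : Measure (UnitAddTorus (Fin d))) =
      ∑ k ∈ Finset.range (n ^ d),
        (π : Measure (UnitAddTorus (Fin d))).real (nearestIndex hn ⁻¹' {k}) * c k := by
  have hmeas (k : ℕ) : MeasurableSet (nearestIndex (d := d) hn ⁻¹' {k}) :=
    measurable_nearestIndex hn (measurableSet_singleton k)
  have h1 : (fun y => c (nearestIndex (d := d) hn y)) = fun y => ∑ k ∈ Finset.range (n ^ d),
      (nearestIndex hn ⁻¹' {k}).indicator (fun _ => c k) y := by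
    funext y
    rw [Finset.sum_eq_single_of_mem (nearestIndex hn y)
      (Finset.mem_range.2 (nearestIndex_lt hn y))]
    · simp
    · intro k _ hk
      simp [Ne.symm hk]
  rw [h1, integral_finsetSum _ fun k _ => (integrable_const _).indicator (hmeas k)]
  refine Finset.sum_congr rfl fun k _ => ?_
  rw [integral_indicator (hmeas k)]
  simp [Measure.real]

/-- The measure `ν` is chosen before `f`, so that it serves all translates of `h` at once. Travel
costs twice: `M` times the moving fraction for the moves themselves, and as much again because the
rests fill only the remaining time. -/
theorem exists_curveMeasure_close {d m : ℕ} {α : ℕ → ℝ}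
    (π : ProbabilityMeasure (UnitAddTorus (Fin d))) {C : ℕ → ℝ}
    (hC0 : ∀ i, 0 ≤ C i)
    (hC : ∀ i, 1 ≤ i → ∀ x, |iteratedDeriv i Real.smoothTransition x| ≤ C i)
    {n : ℕ} (hn : 1 ≤ n) {τ T : ℝ} (hτ : 0 < τ) (hT : 0 < T) (hτT : (n : ℝ) ^ d * τ ≤ T)
    (hα : ∀ i, 1 ≤ i → i ≤ m → τ⁻¹ ^ i * C i * (d * (n : ℝ)⁻¹) ≤ α i) :
    ∃ ν ∈ curveMeasures d m α T, ∀ (f : UnitAddTorus (Fin d) → ℝ) (K : NNReal) (M : ℝ),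
      LipschitzWith K f → (∀ x, |f x| ≤ M) →
      |(∫ y, f y ∂(ν : Measure (UnitAddTorus (Fin d)))) -
        ∫ y, f y ∂(π : Measure (UnitAddTorus (Fin d)))| ≤
          K * (n : ℝ)⁻¹ + 2 * M * ((n : ℝ) ^ d * τ / T) := by
  set P : ℕ → ℝ := fun k =>
    (π : Measure (UnitAddTorus (Fin d))).real (nearestIndex hn ⁻¹' {k})
  set R : ℝ := T - (n : ℝ) ^ d * τ
  have hR : 0 ≤ R := sub_nonneg.2 hτT
  -- `R` is the time left after all `n ^ d` moves, including one after the last rest; sharing it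
  -- according to `π` makes the stages end exactly at `T`.
  set w : ℕ → ℝ := fun k => R * P k
  have hw (k : ℕ) : 0 ≤ w k := mul_nonneg hR measureReal_nonneg
  have hPsum : ∑ k ∈ Finset.range (n ^ d), P k = 1 := by
    have := sum_measureReal_nearestIndex hn π fun _ => 1
    simpa [P] using this.symm
  have hend : stageStart w τ (n ^ d) = T := by
    rw [stageStart, Finset.sum_add_distrib, ← Finset.mul_sum, hPsum]
    simp [R]
  set q : ℝ → EuclideanSpace ℝ (Fin d) := fun t => staircase (n ^ d) w τ t • lineDirection d n
  have hs := contDiff_staircase (n ^ d) w τ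
  have hq : ContDiff ℝ ∞ q := hs.smul contDiff_const
  have hp : Continuous (torusProj ∘ q) := continuous_torusProj.comp hq.continuous
  have hadm : torusProj ∘ q ∈ admissibleCurves d m α T := by
    refine torusProj_comp_mem_admissibleCurves hT.le hq fun i h1 hi t => ?_
    have hsi : ContDiffAt ℝ i (staircase (n ^ d) w τ) t :=
      (hs.of_le (by exact_mod_cast le_top)).contDiffAt
    rw [iteratedDeriv_smul_const hsi, norm_smul, Real.norm_eq_abs]
    refine le_trans ?_ (hα i h1 hi)
    exact mul_le_mul (abs_iteratedDeriv_staircase_le hw hτ h1 (hC0 i) (hC i h1) _ t)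
      (norm_lineDirection_le d hn) (norm_nonneg _)
      (mul_nonneg (by positivity) (hC0 i))
  have hvol : volume (Icc 0 T) = ENNReal.ofReal T := by simp
  have hprob : IsProbabilityMeasure (ProbabilityTheory.cond volume (Icc 0 T)) :=
    ProbabilityTheory.cond_isProbabilityMeasure_of_finite (by simp [hT]) (by simp)
  refine ⟨⟨Measure.map (torusProj ∘ q) (ProbabilityTheory.cond volume (Icc 0 T)),
    Measure.isProbabilityMeasure_map hp.aemeasurable⟩, ⟨_, hadm, rfl⟩, fun f K M hf hM => ?_⟩
  have hM0 : 0 ≤ M := (abs_nonneg _).trans (hM 0)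
  have hν : ∫ y, f y ∂(Measure.map (torusProj ∘ q) (ProbabilityTheory.cond volume (Icc 0 T))) =
      T⁻¹ * ∫ t in (0 : ℝ)..T, f (torusProj (q t)) := by
    rw [integral_map hp.aemeasurable hf.continuous.aestronglyMeasurable, ProbabilityTheory.cond,
      integral_smul_measure, hvol, intervalIntegral.integral_of_le hT.le,
      integral_Icc_eq_integral_Ioc, ENNReal.toReal_inv, ENNReal.toReal_ofReal hT.le]
    rfl
  set c : ℕ → ℝ := fun k => f (torusProj ((k : ℝ) • lineDirection d n))
  have hint := abs_integral_stages_sub_le hw hτ (g := fun t => f (torusProj (q t)))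
    (hf.continuous.comp hp) (fun t => hM _) (c := c) (n ^ d) (fun k hk t ht => by
      simp only [q, c, staircase_eq_of_mem_rest hw hτ hk ht])
  rw [hend] at hint
  set S : ℝ := ∫ y, c (nearestIndex hn y) ∂(π : Measure (UnitAddTorus (Fin d)))
  have hsum : ∑ k ∈ Finset.range (n ^ d), w k * c k = R * S := by
    simp only [S, sum_measureReal_nearestIndex hn π c, Finset.mul_sum, w, P, mul_assoc]
  rw [hsum] at hint
  have hcont : Continuous f := hf.continuous
  have hfint : Integrable f (π : Measure (UnitAddTorus (Fin d))) :=
    Integrable.of_bound hcont.aestronglyMeasurable M (Eventually.of_forall hM)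
  have hcint : Integrable (fun y => c (nearestIndex hn y))
      (π : Measure (UnitAddTorus (Fin d))) :=
    Integrable.of_bound
      ((measurable_from_nat (f := c)).comp (measurable_nearestIndex hn)).aestronglyMeasurable M
      (Eventually.of_forall fun y => hM _)
  have hS : |S - ∫ y, f y ∂(π : Measure (UnitAddTorus (Fin d)))| ≤ K * (n : ℝ)⁻¹ := by
    rw [← integral_sub hcint hfint]
    have := norm_integral_le_of_norm_le_const (μ := (π : Measure (UnitAddTorus (Fin d))))
      (f := fun y => c (nearestIndex hn y) - f y) (C := K * (n : ℝ)⁻¹)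
      (Eventually.of_forall fun y => by
        rw [← dist_eq_norm]
        exact (hf.dist_le_mul _ _).trans
          (mul_le_mul_of_nonneg_left (dist_nearestIndex_le hn y) K.2))
    simpa using this
  have hSM : |S| ≤ M := by
    have := norm_integral_le_of_norm_le_const (μ := (π : Measure (UnitAddTorus (Fin d))))
      (f := fun y => c (nearestIndex hn y)) (C := M) (Eventually.of_forall fun y => hM _)
    simpa using this
  change |(∫ y, f y ∂(Measure.map (torusProj ∘ q) (ProbabilityTheory.cond volume (Icc 0 T)))) -
    _| ≤ _
  rw [hν]
  set I := ∫ t in (0 : ℝ)..T, f (torusProj (q t))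
  set J := ∫ y, f y ∂(π : Measure (UnitAddTorus (Fin d)))
  set F := (n : ℝ) ^ d * τ / T
  have hF0 : 0 ≤ F := by positivity
  have hRF : T⁻¹ * R = 1 - F := by
    simp only [R, F]; field_simp
  have h1 : |T⁻¹ * (I - R * S)| ≤ F * M := by
    rw [abs_mul, abs_of_pos (inv_pos.2 hT)]
    calc T⁻¹ * |I - R * S| ≤ T⁻¹ * (((n ^ d : ℕ) : ℝ) * τ * M) :=
          mul_le_mul_of_nonneg_left hint (by positivity)
      _ = F * M := by simp only [F]; push_cast; field_simp
  have h2 : |F * S| ≤ F * M := by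
    rw [abs_mul, abs_of_nonneg hF0]; exact mul_le_mul_of_nonneg_left hSM hF0
  -- The three terms are the moves, the deficit of resting time, and the discretisation of `π`.
  have h3 : T⁻¹ * I - J = T⁻¹ * (I - R * S) - F * S + (S - J) := by
    linear_combination S * hRF
  rw [h3]
  calc _ ≤ |T⁻¹ * (I - R * S)| + |F * S| + |S - J| :=
        (abs_add_le _ _).trans (add_le_add_left (abs_sub _ _) _)
    _ ≤ F * M + F * M + K * (n : ℝ)⁻¹ := by gcongr
    _ = _ := by ring

/-! ### The kernel norm and Fourier coefficients -/

instance (d : ℕ) : IsProbabilityMeasure (torusVolume d) := by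
  unfold torusVolume; infer_instance

instance (d : ℕ) : (torusVolume d).IsAddHaarMeasure := by
  unfold torusVolume; infer_instance

section KernelNorm

variable {d : ℕ} {h : UnitAddTorus (Fin d) → ℝ}

theorem integrable_of_continuous {X E : Type*} [TopologicalSpace X] [CompactSpace X]
    [MeasurableSpace X] [OpensMeasurableSpace X] [NormedAddCommGroup E]
    [SecondCountableTopologyEither X E] (μ : Measure X) [IsFiniteMeasure μ]
    {f : X → E} (hf : Continuous f) : Integrable f μ := by
  obtain ⟨C, hC⟩ := isCompact_univ.exists_bound_of_continuousOn hf.continuousOn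
  exact Integrable.of_bound hf.aestronglyMeasurable C
    (Eventually.of_forall fun x => hC x (mem_univ x))

theorem conv_diffMeasure (hh : Continuous h) (μ π : ProbabilityMeasure (UnitAddTorus (Fin d)))
    (x : UnitAddTorus (Fin d)) :
    conv h (diffMeasure μ π) x = (∫ y, h (x - y) ∂(μ : Measure (UnitAddTorus (Fin d)))) -
      ∫ y, h (x - y) ∂(π : Measure (UnitAddTorus (Fin d))) := by
  have hint (ν : ProbabilityMeasure (UnitAddTorus (Fin d))) :
      (ν : Measure (UnitAddTorus (Fin d))).toSignedMeasure.Integrable fun y => h (x - y) := by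
    rw [VectorMeasure.Integrable, Measure.variation_toSignedMeasure]
    exact integrable_of_continuous _ (by fun_prop)
  rw [conv, diffMeasure, VectorMeasure.integral_sub_vectorMeasure (hint μ) (hint π),
    VectorMeasure.integral_toSignedMeasure, VectorMeasure.integral_toSignedMeasure]

theorem kernelNorm_le {ν : SignedMeasure (UnitAddTorus (Fin d))} {B : ℝ}
    (hB : ∀ x, |conv h ν x| ≤ B) : kernelNorm h ν ≤ B := by
  have hB0 : 0 ≤ B := (abs_nonneg _).trans (hB 0)
  refine Real.sqrt_le_iff.2 ⟨hB0, ?_⟩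
  calc ∫ x, (conv h ν x) ^ 2 ∂(torusVolume d) ≤ ∫ _x, B ^ 2 ∂(torusVolume d) :=
        integral_mono_of_nonneg (Eventually.of_forall fun x => sq_nonneg _) (integrable_const _)
          (Eventually.of_forall fun x => sq_le_sq' (neg_le_of_abs_le (hB x)) (le_of_abs_le (hB x)))
    _ = B ^ 2 := by simp

theorem continuous_integral_sub (hh : Continuous h) (μ : Measure (UnitAddTorus (Fin d)))
    [IsFiniteMeasure μ] : Continuous fun x => ∫ y, h (x - y) ∂μ := by
  obtain ⟨C, hC⟩ := isCompact_univ.exists_bound_of_continuousOn hh.continuousOn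
  exact continuous_of_dominated (bound := fun _ => C)
    (fun x => (by fun_prop : Continuous fun y => h (x - y)).aestronglyMeasurable)
    (fun x => Eventually.of_forall fun y => hC _ (mem_univ _)) (integrable_const _)
    (Eventually.of_forall fun y => by fun_prop)

theorem continuous_conv_diffMeasure (hh : Continuous h)
    (μ π : ProbabilityMeasure (UnitAddTorus (Fin d))) :
    Continuous (conv h (diffMeasure μ π)) := by
  rw [show conv h (diffMeasure μ π) = _ from funext (conv_diffMeasure hh μ π)]
  exact (continuous_integral_sub hh _).sub (continuous_integral_sub hh _)

theorem mFourier_apply_add (n : Fin d → ℤ) (x y : UnitAddTorus (Fin d)) :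
    UnitAddTorus.mFourier n (x + y) = UnitAddTorus.mFourier n x * UnitAddTorus.mFourier n y := by
  simp only [UnitAddTorus.mFourier, ContinuousMap.coe_mk, ← Finset.prod_mul_distrib]
  refine Finset.prod_congr rfl fun i _ => ?_
  simp [fourier_apply, AddCircle.toCircle_add]

theorem mFourierCoeff_eq_integral_torusVolume (f : UnitAddTorus (Fin d) → ℂ) (n : Fin d → ℤ) :
    UnitAddTorus.mFourierCoeff f n = ∫ x, UnitAddTorus.mFourier (-n) x * f x ∂(torusVolume d) :=
  rfl

/-- The Fourier coefficients of the convolution of a function and a measure. -/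
theorem integral_mFourier_mul_convolution (hh : Continuous h)
    (μ : Measure (UnitAddTorus (Fin d))) [IsFiniteMeasure μ] (n : Fin d → ℤ) :
    ∫ x, UnitAddTorus.mFourier (-n) x * ((∫ y, h (x - y) ∂μ : ℝ) : ℂ) ∂(torusVolume d) =
      UnitAddTorus.mFourierCoeff (fun x => (h x : ℂ)) n *
        ∫ y, UnitAddTorus.mFourier (-n) y ∂μ := by
  set e := UnitAddTorus.mFourier (-n)
  have hcont : Continuous fun z : UnitAddTorus (Fin d) × UnitAddTorus (Fin d) =>
      e z.1 * (h (z.1 - z.2) : ℂ) := by fun_prop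
  calc ∫ x, e x * ((∫ y, h (x - y) ∂μ : ℝ) : ℂ) ∂(torusVolume d)
      = ∫ x, ∫ y, e x * (h (x - y) : ℂ) ∂μ ∂(torusVolume d) := by
        refine integral_congr_ae (Eventually.of_forall fun x => ?_)
        simp only [integral_const_mul, integral_complex_ofReal]
    _ = ∫ y, ∫ x, e x * (h (x - y) : ℂ) ∂(torusVolume d) ∂μ :=
        integral_integral_swap (integrable_of_continuous _ hcont)
    _ = ∫ y, UnitAddTorus.mFourierCoeff (fun x => (h x : ℂ)) n * e y ∂μ := by
        refine integral_congr_ae (Eventually.of_forall fun y => ?_)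
        -- Translation invariance replaces `x` by `x + y`, and the character splits off its value at
        -- `y`.
        have := integral_sub_right_eq_self (μ := torusVolume d)
          (fun x => e (x + y) * (h x : ℂ)) y
        simp only [sub_add_cancel] at this
        simp only [this, mFourierCoeff_eq_integral_torusVolume, ← integral_mul_const]
        refine integral_congr_ae (Eventually.of_forall fun x => ?_)
        simp only [e, mFourier_apply_add]
        ring
    _ = _ := integral_const_mul _ _

/-- The left side is the modulus of a Fourier coefficient of `h ⋆ (μ - π)`, hence at most the `L¹`
norm, itself at most the `L²` norm on a probability space. -/
theorem norm_mFourierCoeff_mul_le_kernelNorm (hh : Continuous h)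
    (μ π : ProbabilityMeasure (UnitAddTorus (Fin d))) (n : Fin d → ℤ) :
    ‖UnitAddTorus.mFourierCoeff (fun x => (h x : ℂ)) n‖ *
      ‖(∫ y, UnitAddTorus.mFourier (-n) y ∂(μ : Measure (UnitAddTorus (Fin d)))) -
        ∫ y, UnitAddTorus.mFourier (-n) y ∂(π : Measure (UnitAddTorus (Fin d)))‖ ≤
      kernelNorm h (diffMeasure μ π) := by
  set G := conv h (diffMeasure μ π) with hG
  have hGc : Continuous G := continuous_conv_diffMeasure hh μ π
  have hint (ν : ProbabilityMeasure (UnitAddTorus (Fin d))) : Integrable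
      (fun x => UnitAddTorus.mFourier (-n) x *
        ((∫ y, h (x - y) ∂(ν : Measure (UnitAddTorus (Fin d))) : ℝ) : ℂ)) (torusVolume d) := by
    have := continuous_integral_sub hh (ν : Measure (UnitAddTorus (Fin d)))
    exact integrable_of_continuous _ (by fun_prop)
  have h1 : ∫ x, UnitAddTorus.mFourier (-n) x * (G x : ℂ) ∂(torusVolume d) =
      UnitAddTorus.mFourierCoeff (fun x => (h x : ℂ)) n *
      ((∫ y, UnitAddTorus.mFourier (-n) y ∂(μ : Measure (UnitAddTorus (Fin d)))) -
        ∫ y, UnitAddTorus.mFourier (-n) y ∂(π : Measure (UnitAddTorus (Fin d)))) := by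
    rw [mul_sub, ← integral_mFourier_mul_convolution hh, ← integral_mFourier_mul_convolution hh,
      ← integral_sub (hint μ) (hint π)]
    refine integral_congr_ae (Eventually.of_forall fun x => ?_)
    simp only [hG, conv_diffMeasure hh, Complex.ofReal_sub, mul_sub]
  have h2 : ‖∫ x, UnitAddTorus.mFourier (-n) x * (G x : ℂ) ∂(torusVolume d)‖ ≤
      ∫ x, |G x| ∂(torusVolume d) := by
    refine norm_integral_le_of_norm_le (integrable_of_continuous _ hGc.abs)
      (Eventually.of_forall fun x => ?_)
    rw [norm_mul, Complex.norm_real, Real.norm_eq_abs]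
    refine mul_le_of_le_one_left (abs_nonneg _) ?_
    exact (ContinuousMap.norm_coe_le_norm _ x).trans_eq UnitAddTorus.mFourier_norm
  have h3 : (∫ x, |G x| ∂(torusVolume d)) ^ 2 ≤ ∫ x, (G x) ^ 2 ∂(torusVolume d) := by
    have hL : MemLp (fun x => |G x|) 2 (torusVolume d) :=
      (memLp_two_iff_integrable_sq hGc.abs.aestronglyMeasurable).2
        (integrable_of_continuous _ (hGc.abs.pow 2))
    -- The comparison of `L¹` and `L²` is the nonnegativity of the variance of `|G|`.
    have h4 := ProbabilityTheory.variance_eq_sub hL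
    have h5 := ProbabilityTheory.variance_nonneg (fun x => |G x|) (torusVolume d)
    rw [h4] at h5
    simpa using h5
  rw [← norm_mul, ← h1, kernelNorm]
  exact h2.trans (Real.le_sqrt_of_sq_le h3)

end KernelNorm

/-! ### Weak convergence -/

/-- On the torus, convergence of Fourier coefficients implies weak convergence. -/
theorem tendsto_of_tendsto_integral_mFourier {d : ℕ} {ι : Type*} {l : Filter ι}
    {μ : ι → ProbabilityMeasure (UnitAddTorus (Fin d))}
    {π : ProbabilityMeasure (UnitAddTorus (Fin d))}
    (hμ : ∀ n : Fin d → ℤ, Tendsto (fun s => ∫ y, UnitAddTorus.mFourier n y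
      ∂(μ s : Measure (UnitAddTorus (Fin d)))) l
      (𝓝 (∫ y, UnitAddTorus.mFourier n y ∂(π : Measure (UnitAddTorus (Fin d)))))) :
    Tendsto μ l (𝓝 π) := by
  have hint (ν : ProbabilityMeasure (UnitAddTorus (Fin d))) (f : C(UnitAddTorus (Fin d), ℂ)) :
      Integrable f (ν : Measure (UnitAddTorus (Fin d))) :=
    integrable_of_continuous _ f.continuous
  have hspan : ∀ f ∈ Submodule.span ℂ (range (UnitAddTorus.mFourier (d := Fin d))),
      Tendsto (fun s => ∫ y, f y ∂(μ s : Measure (UnitAddTorus (Fin d)))) l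
        (𝓝 (∫ y, f y ∂(π : Measure (UnitAddTorus (Fin d))))) := by
    intro f hf
    induction hf using Submodule.span_induction with
    | mem f hf => obtain ⟨n, rfl⟩ := hf; exact hμ n
    | zero => simpa using tendsto_const_nhds
    | add f g _ _ hf hg =>
      simp only [ContinuousMap.add_apply]
      rw [integral_add (hint π f) (hint π g)]
      refine (hf.add hg).congr fun s => ?_
      rw [integral_add (hint _ f) (hint _ g)]
    | smul c f _ hf =>
      simp only [ContinuousMap.smul_apply, integral_smul]
      exact hf.const_smul c
  rw [ProbabilityMeasure.tendsto_iff_forall_integral_rclike_tendsto ℂ]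
  intro f
  rw [Metric.tendsto_nhds]
  intro ε hε
  have hmem : f.toContinuousMap ∈ closure
      (Submodule.span ℂ (range (UnitAddTorus.mFourier (d := Fin d))) :
        Set C(UnitAddTorus (Fin d), ℂ)) := by
    rw [← Submodule.topologicalClosure_coe, UnitAddTorus.span_mFourier_closure_eq_top]
    trivial
  obtain ⟨g, hg, hfg⟩ := Metric.mem_closure_iff.1 hmem (ε / 3) (by positivity)
  have hclose (ν : ProbabilityMeasure (UnitAddTorus (Fin d))) :
      dist (∫ y, f y ∂(ν : Measure (UnitAddTorus (Fin d))))
        (∫ y, g y ∂(ν : Measure (UnitAddTorus (Fin d)))) ≤ ε / 3 := by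
    have hf : Integrable f (ν : Measure (UnitAddTorus (Fin d))) := hint ν f.toContinuousMap
    rw [dist_eq_norm, ← integral_sub hf (hint ν g)]
    have := norm_integral_le_of_norm_le_const (μ := (ν : Measure (UnitAddTorus (Fin d))))
      (f := fun y => f y - g y) (C := ε / 3) (Eventually.of_forall fun y => by
        rw [← dist_eq_norm]
        exact (ContinuousMap.dist_apply_le_dist (f := f.toContinuousMap) (g := g) y).trans hfg.le)
    simpa using this
  filter_upwards [Metric.tendsto_nhds.1 (hspan g hg) (ε / 3) (by positivity)] with s hs
  have h1 := hclose (μ s)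
  have h2 := hclose π
  rw [dist_comm] at h2
  have h3 := dist_triangle4 (∫ y, f y ∂(μ s : Measure (UnitAddTorus (Fin d))))
    (∫ y, g y ∂(μ s : Measure (UnitAddTorus (Fin d))))
    (∫ y, g y ∂(π : Measure (UnitAddTorus (Fin d))))
    (∫ y, f y ∂(π : Measure (UnitAddTorus (Fin d))))
  linarith

theorem tendsto_of_tendsto_kernelNorm {d : ℕ} {h : UnitAddTorus (Fin d) → ℝ} (hh : Continuous h)
    (hF : ∀ ξ : Fin d → ℤ, UnitAddTorus.mFourierCoeff (fun x => (h x : ℂ)) ξ ≠ 0)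
    {ι : Type*} {l : Filter ι} {μ : ι → ProbabilityMeasure (UnitAddTorus (Fin d))}
    {π : ProbabilityMeasure (UnitAddTorus (Fin d))}
    (hμ : Tendsto (fun s => kernelNorm h (diffMeasure (μ s) π)) l (𝓝 0)) :
    Tendsto μ l (𝓝 π) := by
  refine tendsto_of_tendsto_integral_mFourier fun n => ?_
  -- Integrating `mFourier n` against a measure gives its coefficient at `-n`.
  have hpos : 0 < ‖UnitAddTorus.mFourierCoeff (fun x => (h x : ℂ)) (-n)‖ := norm_pos_iff.2 (hF _)
  rw [tendsto_iff_norm_sub_tendsto_zero]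
  have hlim := hμ.div_const ‖UnitAddTorus.mFourierCoeff (fun x => (h x : ℂ)) (-n)‖
  rw [zero_div] at hlim
  refine squeeze_zero (fun s => norm_nonneg _) (fun s => ?_) hlim
  rw [le_div_iff₀' hpos]
  simpa using norm_mFourierCoeff_mul_le_kernelNorm hh (μ s) π (-n)

/-! ### The rate of convergence -/

/-- One slowdown factor serves all derivative orders; `1 ≤ c` will give `c⁻¹ ^ i ≤ c⁻¹`. -/
theorem exists_one_le_forall_mul_inv_le {m : ℕ} {α C : ℕ → ℝ}
    (hα : ∀ i, 1 ≤ i → i ≤ m → 0 < α i) (hC : ∀ i, 0 ≤ C i) :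
    ∃ c : ℝ, 1 ≤ c ∧ ∀ i, 1 ≤ i → i ≤ m → C i * c⁻¹ ≤ α i := by
  have hnonneg : ∀ i ∈ Finset.Icc 1 m, 0 ≤ C i / α i := fun i hi =>
    div_nonneg (hC i) (hα i (Finset.mem_Icc.1 hi).1 (Finset.mem_Icc.1 hi).2).le
  have hsum := Finset.sum_nonneg hnonneg
  refine ⟨1 + ∑ i ∈ Finset.Icc 1 m, C i / α i, by linarith, fun i h1 hi => ?_⟩
  have hle := Finset.single_le_sum hnonneg (Finset.mem_Icc.2 ⟨h1, hi⟩)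
  rw [div_le_iff₀ (hα i h1 hi)] at hle
  rw [← div_eq_mul_inv, div_le_iff₀ (by linarith)]
  nlinarith [hα i h1 hi]

/-- The infimum over all curve measures of the distance to `π` decays at the given rate. -/
theorem exists_curveMeasure_kernelNorm_le {d m : ℕ} (hd : 1 ≤ d) (hm : 1 ≤ m) {α : ℕ → ℝ}
    (hα : ∀ i, 1 ≤ i → i ≤ m → 0 < α i) {h : UnitAddTorus (Fin d) → ℝ} {K : NNReal}
    (hK : LipschitzWith K h) (π : ProbabilityMeasure (UnitAddTorus (Fin d))) :
    ∃ B : ℝ, ∀ᶠ T : ℝ in atTop, ∃ ν ∈ curveMeasures d m α T,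
      kernelNorm h (diffMeasure ν π) ≤
        B * T ^ (-((m : ℝ) / ((m : ℝ) * ((d : ℝ) + 1) - 1))) := by
  have hC' : ∀ i : ℕ, ∃ C : ℝ, 0 ≤ C ∧
      (1 ≤ i → ∀ x, |iteratedDeriv i Real.smoothTransition x| ≤ C) := by
    intro i
    rcases Nat.lt_or_ge i 1 with hi | hi
    · exact ⟨0, le_rfl, fun h => by omega⟩
    · obtain ⟨C, h0, hC⟩ := exists_bound_iteratedDeriv_smoothTransition hi
      exact ⟨C, h0, fun _ => hC⟩
  choose C hC0 hC using hC'
  obtain ⟨c, hc1, hc⟩ := exists_one_le_forall_mul_inv_le (C := fun i => C i * d) hα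
    fun i => mul_nonneg (hC0 i) (Nat.cast_nonneg d)
  obtain ⟨M, hM⟩ := isCompact_univ.exists_bound_of_continuousOn hK.continuous.continuousOn
  have hM0 : 0 ≤ M := (norm_nonneg _).trans (hM 0 (mem_univ 0))
  have hd1 : (1 : ℝ) ≤ d := by exact_mod_cast hd
  have hm1 : (1 : ℝ) ≤ m := by exact_mod_cast hm
  have hc0 : 0 < c := by linarith
  have hden : 0 < (m : ℝ) * ((d : ℝ) + 1) - 1 := by nlinarith
  set β : ℝ := (m : ℝ) / ((m : ℝ) * ((d : ℝ) + 1) - 1)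
  have hβ : 0 < β := by positivity
  have hβinv : β⁻¹ = d + 1 - (m : ℝ)⁻¹ := by
    simp only [β]; rw [inv_div]; field_simp
  refine ⟨2 * (K + 2 * M * c), ?_⟩
  -- The threshold `c + 1` guarantees `c ≤ n` after taking the floor.
  filter_upwards [(tendsto_rpow_atTop hβ).eventually_ge_atTop (c + 1),
    eventually_gt_atTop 0] with T hTβ hT
  set n := ⌊T ^ β⌋₊
  have hnle : (n : ℝ) ≤ T ^ β := Nat.floor_le (by positivity)
  have hnlt : T ^ β < n + 1 := Nat.lt_floor_add_one _
  have hnc : c ≤ n := by linarith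
  have hn1' : (1 : ℝ) ≤ n := hc1.trans hnc
  have hn1 : 1 ≤ n := by exact_mod_cast hn1'
  have hn0 : (0 : ℝ) < n := by linarith
  -- This is the shortest order of magnitude for which `τ⁻¹ ^ m` is still `O(n)`, compensating the
  -- factor `1/n` of the step length.
  set τ : ℝ := c * (n : ℝ) ^ (-(m : ℝ)⁻¹)
  have hτ : 0 < τ := by positivity
  have hnT : (n : ℝ) ^ β⁻¹ ≤ T := by
    calc (n : ℝ) ^ β⁻¹ ≤ (T ^ β) ^ β⁻¹ := Real.rpow_le_rpow hn0.le hnle (by positivity)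
      _ = T := by rw [← Real.rpow_mul hT.le, mul_inv_cancel₀ hβ.ne', Real.rpow_one]
  have htravel : (n : ℝ) ^ d * τ = c * (n : ℝ)⁻¹ * (n : ℝ) ^ β⁻¹ := by
    rw [hβinv, show (d : ℝ) + 1 - (m : ℝ)⁻¹ = d + 1 + -(m : ℝ)⁻¹ by ring, Real.rpow_add hn0,
      Real.rpow_add hn0, Real.rpow_one, Real.rpow_natCast]
    simp only [τ]
    field_simp
  have hcn : c * (n : ℝ)⁻¹ ≤ 1 := by
    rw [← div_eq_mul_inv, div_le_one hn0]; exact hnc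
  have hfrac : (n : ℝ) ^ d * τ / T ≤ c * (n : ℝ)⁻¹ := by
    rw [htravel, div_le_iff₀ hT]
    exact mul_le_mul_of_nonneg_left hnT (by positivity)
  have hτT : (n : ℝ) ^ d * τ ≤ T := by
    have := hfrac.trans hcn
    rwa [div_le_one hT] at this
  have hspeed : ∀ i, 1 ≤ i → i ≤ m → τ⁻¹ ^ i * C i * (d * (n : ℝ)⁻¹) ≤ α i := by
    intro i h1 hi
    have hτi : τ⁻¹ ^ i ≤ c⁻¹ * n := by
      simp only [τ]
      rw [mul_inv, mul_pow, Real.rpow_neg hn0.le, inv_inv, ← Real.rpow_mul_natCast hn0.le]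
      refine mul_le_mul ?_ ?_ (by positivity) (by positivity)
      · exact pow_le_of_le_one (by positivity) (inv_le_one_of_one_le₀ hc1) (by omega)
      · refine (Real.rpow_le_rpow_of_exponent_le hn1' ?_).trans_eq (Real.rpow_one _)
        rw [inv_mul_le_iff₀ (by linarith), mul_one]
        exact_mod_cast hi
    calc τ⁻¹ ^ i * C i * (d * (n : ℝ)⁻¹) = τ⁻¹ ^ i * (C i * (d * (n : ℝ)⁻¹)) := by ring
      _ ≤ c⁻¹ * n * (C i * (d * (n : ℝ)⁻¹)) :=
          mul_le_mul_of_nonneg_right hτi (mul_nonneg (hC0 i) (by positivity))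
      _ = C i * d * c⁻¹ := by field_simp
      _ ≤ α i := hc i h1 hi
  obtain ⟨ν, hν, hclose⟩ := exists_curveMeasure_close π hC0 hC hn1 hτ hT hτT hspeed
  refine ⟨ν, hν, ?_⟩
  have hbound : kernelNorm h (diffMeasure ν π) ≤
      K * (n : ℝ)⁻¹ + 2 * M * ((n : ℝ) ^ d * τ / T) := by
    refine kernelNorm_le fun x => ?_
    rw [conv_diffMeasure hK.continuous]
    refine hclose (fun y => h (x - y)) K M ?_ fun y => hM _ (mem_univ _)
    refine LipschitzWith.of_dist_le_mul fun y z => ?_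
    exact (hK.dist_le_mul (x - y) (x - z)).trans_eq (by rw [dist_sub_left])
  -- Here `T ^ β < n + 1 ≤ 2 * n`.
  have hninv : (n : ℝ)⁻¹ ≤ 2 * T ^ (-β) := by
    rw [Real.rpow_neg hT.le, ← div_eq_mul_inv, inv_le_iff_one_le_mul₀ hn0, div_mul_eq_mul_div,
      le_div_iff₀ (by positivity)]
    linarith
  calc kernelNorm h (diffMeasure ν π)
      ≤ K * (n : ℝ)⁻¹ + 2 * M * (c * (n : ℝ)⁻¹) := hbound.trans (by gcongr)
    _ = (K + 2 * M * c) * (n : ℝ)⁻¹ := by ring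
    _ ≤ (K + 2 * M * c) * (2 * T ^ (-β)) := by gcongr
    _ = _ := by ring

end LineDrawing

end

theorem mainTheorem2 (d m : ℕ) (hd : 1 ≤ d) (hm : 1 ≤ m)
    (α : ℕ → ℝ) (hα : ∀ i, 1 ≤ i → i ≤ m → 0 < α i)
    (h : UnitAddTorus (Fin d) → ℝ) (hLip : ∃ L, LipschitzWith L h)
    (π : ProbabilityMeasure (UnitAddTorus (Fin d)))
    (μ : ℝ → ProbabilityMeasure (UnitAddTorus (Fin d)))
    (hμ : ∀ T : ℝ, 0 < T → LineDrawing.IsProjection m α h π T (μ T)) :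
    ((∀ ξ : Fin d → ℤ, UnitAddTorus.mFourierCoeff (fun x => (h x : ℂ)) ξ ≠ 0) →
      Tendsto μ atTop (𝓝 π)) ∧
    (fun T : ℝ => LineDrawing.kernelNorm h (LineDrawing.diffMeasure (μ T) π)) =O[atTop]
      (fun T : ℝ => T ^ (-((m : ℝ) / ((m : ℝ) * ((d : ℝ) + 1) - 1)))) := by
  obtain ⟨K, hK⟩ := hLip
  have hrate : (fun T : ℝ => LineDrawing.kernelNorm h (LineDrawing.diffMeasure (μ T) π)) =O[atTop]
      (fun T : ℝ => T ^ (-((m : ℝ) / ((m : ℝ) * ((d : ℝ) + 1) - 1)))) := by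
    obtain ⟨B, hB⟩ := LineDrawing.exists_curveMeasure_kernelNorm_le hd hm hα hK π
    refine Asymptotics.IsBigO.of_bound B ?_
    filter_upwards [hB, eventually_gt_atTop 0] with T ⟨ν, hν, hle⟩ hT
    have hnonneg : 0 ≤ LineDrawing.kernelNorm h (LineDrawing.diffMeasure (μ T) π) :=
      Real.sqrt_nonneg _
    rw [Real.norm_of_nonneg hnonneg, Real.norm_of_nonneg (by positivity)]
    exact ((hμ T hT).2 ν hν).trans hle
  refine ⟨fun hF => ?_, hrate⟩
  have hd1 : (1 : ℝ) ≤ d := by exact_mod_cast hd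
  have hm1 : (1 : ℝ) ≤ m := by exact_mod_cast hm
  have hden : 0 < (m : ℝ) * ((d : ℝ) + 1) - 1 := by nlinarith
  -- The exponent in the rate is negative, so the kernel norm tends to `0`.
  exact LineDrawing.tendsto_of_tendsto_kernelNorm hK.continuous hF
    (hrate.trans_tendsto (tendsto_rpow_neg_atTop (by positivity)))
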